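/- Let $F$ be a $p$-adic field with ring of integers $\mathcal O_F$, maximal ideal $(\varpi)$ and residue field of cardinality $q$, let $G=\mathrm{GL}_2(F)$, and let $A\subset\mathbb C$ be a principal ideal domain in which $p$ is invertible. For $n\ge 0$ let $$U_1(\varpi^n)=\Big\{\gamma\in \mathrm{GL}_2(\mathcal O_F):\ \gamma\equiv\begin{pmatrix}*&*\\0&1\end{pmatrix}\pmod{\varpi^n}\Big\}.$$ For an infinite-dimensional irreducible smooth complex representation $\pi$ of $G$, let the conductor exponent $c(\pi)$ be the least $n$ with $\pi^{U_1(\varpi^n)}\ne0$, and let $\pi^{\mathrm{new}}=\pi^{U_1(\varpi^{c(\pi)})}$, which is a line; a newform $v^{\mathrm{new}}$ is a basis vector of this line. An $A$-model of $\pi$ is a $G$-stable $A$-submodule $\pi_A\subset\pi$ such that the natural map $\pi_A\otimes_A\mathbb C\to\pi$ is an isomorphism and $\pi_A^H$ is a free $A$-module of finite type for every compact open subgroup $H\le G$. Let $\pi_1,\pi_2$ be infinite-dimensional irreducible smooth complex representations of $G$ that are dual to each other in the sense that $\mathrm{Hom}_{\mathbb C[G]}(\pi_1\otimes\pi_2,\mathbb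 C)\neq0$, and assume that they are ramified, i.e. $c(\pi_1)\ge1$ (equivalently $c(\pi_2)\ge 1$). Let $\pi_{1,A},\pi_{2,A}$ be $A$-models of $\pi_1,\pi_2$ such that each $\pi_{i,A}$ is generated over $A[G]$ by a newform $v_i^{\mathrm{new}}\in\pi_{i,A}$. Let $A\twoheadrightarrow B$ be a surjective homomorphism of commutative rings, and put $\pi_{i,B}=\pi_{i,A}\otimes_AB$, $v_{i,B}^{\mathrm{new}}=v_i^{\mathrm{new}}\otimes1$. Then: 1. The cokernel of the homomorphism $$\mathrm{Hom}_{A[G]}(\pi_{1,A}\otimes\pi_{2,A},A)\longrightarrow\mathrm{Hom}_{B[G]}(\pi_{1,B}\otimes\pi_{2,B},B),\qquad \mathcal P\longmapsto\mathcal P\otimes B$$ is annihilated by $(q-1)^2$. 2. More precisely, there is a unique $\mathcal P_0\in\mathrm{Hom}_{A[G]}(\pi_{1,A}\otimes\pi_{2,A},A)$ with $\mathcal P_0(v_1^{\mathrm{new}},v_2^{\mathrm{new}})=q-1$, and for every $\mathcal P_B\in\mathrm{Hom}_{B[G]}(\pi_{1,B}\otimes\pi_{2,B},B)$ $$(q-1)^2\cdot\mathcal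 P_B=(q-1)\cdot\mathcal P_B(v_{1,B}^{\mathrm{new}},v_{2,B}^{\mathrm{new}})\cdot(\mathcal P_0\otimes B).$$ -/

import Mathlib

open scoped TensorProduct ValuativeRel

namespace GL2Pairing

noncomputable section

/-! ### The groups `U₁(ϖⁿ)` -/

/-- For an ideal `I` of `R`, the matrices in `GL₂(R)` that are congruent to
`(* *; 0 1)` modulo `I`. -/
def U1Ideal {R : Type*} [CommRing R] (I : Ideal R) :
    Subgroup (Matrix.GeneralLinearGroup (Fin 2) R) where
  carrier := {g | g.val 1 0 ∈ I ∧ g.val 1 1 - 1 ∈ I}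
  one_mem' := by simp
  mul_mem' := by
    rintro a b ⟨ha, ha'⟩ ⟨hb, hb'⟩
    simp only [Set.mem_ofPred_eq, Units.val_mul, Matrix.mul_apply, Fin.sum_univ_two]
    refine ⟨I.add_mem (I.mul_mem_right _ ha) (I.mul_mem_left _ hb), ?_⟩
    have h : a.val 1 0 * b.val 0 1 + a.val 1 1 * b.val 1 1 - 1
        = a.val 1 0 * b.val 0 1 + (a.val 1 1 * (b.val 1 1 - 1) + (a.val 1 1 - 1)) := by ring
    rw [h]
    exact I.add_mem (I.mul_mem_right _ ha) (I.add_mem (I.mul_mem_left _ hb') ha')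
  inv_mem' := by
    rintro a ⟨ha, ha'⟩
    have h : a.val * (a⁻¹).val = 1 := by rw [← Units.val_mul]; simp
    have h0 := congrFun (congrFun h 1) 0
    have h1 := congrFun (congrFun h 1) 1
    simp only [Matrix.mul_apply, Fin.sum_univ_two, Matrix.one_apply] at h0 h1
    norm_num at h0 h1
    simp only [Set.mem_ofPred_eq]
    have e0 : (a⁻¹).val 1 0
        = -(a.val 1 0 * (a⁻¹).val 0 0) - (a.val 1 1 - 1) * (a⁻¹).val 1 0 := by
      simp only [Matrix.coe_units_inv]
      linear_combination h0
    have e1 : (a⁻¹).val 1 1 - 1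
        = -(a.val 1 0 * (a⁻¹).val 0 1) - (a.val 1 1 - 1) * (a⁻¹).val 1 1 := by
      simp only [Matrix.coe_units_inv]
      linear_combination h1
    refine ⟨?_, ?_⟩
    · rw [e0]
      exact I.sub_mem (I.neg_mem (I.mul_mem_right _ ha)) (I.mul_mem_right _ ha')
    · rw [e1]
      exact I.sub_mem (I.neg_mem (I.mul_mem_right _ ha)) (I.mul_mem_right _ ha')

section LocalField

variable (F : Type*) [Field F] [ValuativeRel F]

/-- The subgroup `U₁(ϖⁿ)` of `GL₂(𝒪_F)`, viewed in `GL₂(F)`. For `n = 0` it is `GL₂(𝒪_F)`. -/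
def U1 (n : ℕ) : Subgroup (Matrix.GeneralLinearGroup (Fin 2) F) :=
  (U1Ideal (𝓂[F] ^ n)).map (Matrix.GeneralLinearGroup.map (algebraMap 𝒪[F] F))

end LocalField

/-! ### Smooth representations, conductors and newforms -/

/-- The subspace `V^H` of vectors fixed by a subgroup `H`. -/
def fixedVectors {k G V : Type*} [CommRing k] [Group G] [AddCommGroup V] [Module k V]
    (ρ : Representation k G V) (H : Subgroup G) : Submodule k V :=
  Representation.invariants (ρ.comp H.subtype)

/-- Smoothness: every vector is fixed by an open subgroup. -/
def IsSmooth {k G V : Type*} [CommRing k] [Group G] [TopologicalSpace G] [AddCommGroup V]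
    [Module k V] (ρ : Representation k G V) : Prop :=
  ∀ v : V, ∃ H : Subgroup G, IsOpen (H : Set G) ∧ v ∈ fixedVectors ρ H

section Newform

variable {F : Type*} [Field F] [ValuativeRel F] {V : Type*} [AddCommGroup V] [Module ℂ V]
  (ρ : Representation ℂ (Matrix.GeneralLinearGroup (Fin 2) F) V)

/-- The conductor exponent of `π`: the least `n` such that `U₁(ϖⁿ)` fixes a nonzero vector. -/
def conductor : ℕ := sInf {n | fixedVectors ρ (U1 F n) ≠ ⊥}

/-- The space `π^new` of newforms: the vectors fixed by `U₁(ϖᶜ)`, `c` the conductor exponent. -/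
def newSpace : Submodule ℂ V := fixedVectors ρ (U1 F (conductor ρ))

/-- `v` is a newform `v^new` of `π`: a basis vector of the line `π^new`. -/
def IsNewform (v : V) : Prop := v ≠ 0 ∧ newSpace ρ = Submodule.span ℂ {v}

end Newform

/-! ### Models over a subring of `ℂ` -/

section Model

variable {G V : Type*} [Group G] [AddCommGroup V] [Module ℂ V]

/-- `M ⊆ V` is an `A`-model of the representation `ρ` on `V`: the natural map
`M ⊗_A ℂ → V` is an isomorphism, `M` is `G`-stable, and `M^H` is free of finite type over `A`
for each compact open subgroup `H`. -/
structure IsModel [TopologicalSpace G] (A : Subring ℂ) (ρ : Representation ℂ G V)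
    (M : Submodule A V) : Prop where
  baseChange : IsBaseChange ℂ M.subtype
  stable : ∀ g : G, ∀ v ∈ M, ρ g v ∈ M
  free : ∀ H : Subgroup G, IsOpen (H : Set G) → IsCompact (H : Set G) →
    Module.Free A ↥(M ⊓ (fixedVectors ρ H).restrictScalars A)
  finite : ∀ H : Subgroup G, IsOpen (H : Set G) → IsCompact (H : Set G) →
    Module.Finite A ↥(M ⊓ (fixedVectors ρ H).restrictScalars A)

/-- The action of `G` on a `G`-stable `A`-submodule. -/
def restrictRep {A : Subring ℂ} (ρ : Representation ℂ G V) (M : Submodule A V)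
    (hM : ∀ g : G, ∀ v ∈ M, ρ g v ∈ M) : Representation A G M where
  toFun g := ((ρ g).restrictScalars A).restrict (hM g)
  map_one' := by ext v; simp
  map_mul' g h := by
    ext v
    change ρ (g * h) (v : V) = ρ g (ρ h (v : V))
    rw [map_mul]
    rfl

end Model

/-! ### Invariant pairings and their base change -/

section Pairing

variable {G : Type*} [Group G]

/-- `Hom_{R[G]}(M₁ ⊗ M₂, R)`: the `G`-invariant pairings, `G` acting diagonally on `M₁ ⊗ M₂` and
trivially on `R`. -/
abbrev InvPairing {R M₁ M₂ : Type*} [CommRing R] [AddCommGroup M₁] [Module R M₁]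
    [AddCommGroup M₂] [Module R M₂] (σ₁ : Representation R G M₁) (σ₂ : Representation R G M₂) :
    Type _ :=
  Representation.IntertwiningMap (σ₁.tprod σ₂) (Representation.trivial R G R)

variable {A M M₁ M₂ : Type*} [CommRing A] [AddCommGroup M] [Module A M]
  [AddCommGroup M₁] [Module A M₁] [AddCommGroup M₂] [Module A M₂]
  (B : Type*) [CommRing B] [Algebra A B]

/-- The representation of `G` on `B ⊗_A M`. -/
def baseChangeRep (σ : Representation A G M) : Representation B G (B ⊗[A] M) where
  toFun g := (σ g).baseChange B
  map_one' := by
    rw [map_one]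
    exact LinearMap.baseChange_id
  map_mul' g h := by
    rw [map_mul]
    exact LinearMap.baseChange_mul _ _

variable {σ₁ : Representation A G M₁} {σ₂ : Representation A G M₂}

/-- The `B`-linear map underlying `𝒫 ⊗ B`:
`(B ⊗ M₁) ⊗_B (B ⊗ M₂) ≅ B ⊗ (M₁ ⊗ M₂) → B ⊗ A ≅ B`. -/
def baseChangeLin (P : InvPairing σ₁ σ₂) : (B ⊗[A] M₁) ⊗[B] (B ⊗[A] M₂) →ₗ[B] B :=
  (TensorProduct.AlgebraTensorModule.rid A B B).toLinearMap ∘ₗ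
    P.toLinearMap.baseChange B ∘ₗ
      (TensorProduct.AlgebraTensorModule.distribBaseChange A B M₁ M₂).symm.toLinearMap

theorem baseChangeLin_tmul (P : InvPairing σ₁ σ₂) (b₁ b₂ : B) (m₁ : M₁) (m₂ : M₂) :
    baseChangeLin B P ((b₁ ⊗ₜ[A] m₁) ⊗ₜ[B] (b₂ ⊗ₜ[A] m₂))
      = b₁ * b₂ * algebraMap A B (P (m₁ ⊗ₜ[A] m₂)) := by
  have h : (TensorProduct.AlgebraTensorModule.distribBaseChange A B M₁ M₂).symm
      ((b₁ ⊗ₜ[A] m₁) ⊗ₜ[B] (b₂ ⊗ₜ[A] m₂)) = (b₁ * b₂) ⊗ₜ[A] (m₁ ⊗ₜ[A] m₂) := by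
    rw [LinearEquiv.symm_apply_eq, TensorProduct.AlgebraTensorModule.distribBaseChange_tmul]
    have e : ∀ (b : B) (m : M₁), (b ⊗ₜ[A] m : B ⊗[A] M₁) = b • (1 ⊗ₜ[A] m) := fun b m => by
      rw [TensorProduct.smul_tmul', smul_eq_mul, mul_one]
    have e' : (b₂ ⊗ₜ[A] m₂ : B ⊗[A] M₂) = b₂ • (1 ⊗ₜ[A] m₂) := by
      rw [TensorProduct.smul_tmul', smul_eq_mul, mul_one]
    rw [e b₁, e', TensorProduct.smul_tmul_smul, e (b₁ * b₂), TensorProduct.smul_tmul']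
  simp only [baseChangeLin, LinearMap.comp_apply, LinearEquiv.coe_coe]
  rw [h]
  simp [Algebra.smul_def, mul_comm]

/-- The base change `𝒫 ↦ 𝒫 ⊗ B` from `Hom_{A[G]}(M₁ ⊗ M₂, A)` to
`Hom_{B[G]}(M_{1,B} ⊗ M_{2,B}, B)`; it is linear along `A → B`. -/
def baseChangePairing :
    InvPairing σ₁ σ₂ →ₛₗ[algebraMap A B]
      InvPairing (baseChangeRep B σ₁) (baseChangeRep B σ₂) where
  toFun P :=
    { toLinearMap := baseChangeLin B P
      isIntertwining' := by
        intro g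
        ext m₁ m₂
        have h := LinearMap.congr_fun (P.isIntertwining' g) (m₁ ⊗ₜ[A] m₂)
        have h' : P (σ₁ g m₁ ⊗ₜ[A] σ₂ g m₂) = P (m₁ ⊗ₜ[A] m₂) := by
          simpa [Representation.tprod_apply] using h
        simp [baseChangeRep, Representation.tprod_apply, baseChangeLin_tmul, h'] }
  map_add' P Q := by
    apply Representation.IntertwiningMap.ext
    ext m₁ m₂
    simp [baseChangeLin_tmul]
  map_smul' a P := by
    apply Representation.IntertwiningMap.ext
    ext m₁ m₂
    simp [baseChangeLin_tmul, Algebra.smul_def]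

/-- On pure tensors `𝒫 ⊗ B` is given by the image of `𝒫` in `B`. -/
theorem baseChangePairing_tmul (P : InvPairing σ₁ σ₂) (b₁ b₂ : B) (m₁ : M₁) (m₂ : M₂) :
    baseChangePairing B P ((b₁ ⊗ₜ[A] m₁) ⊗ₜ[B] (b₂ ⊗ₜ[A] m₂))
      = b₁ * b₂ * algebraMap A B (P (m₁ ⊗ₜ[A] m₂)) :=
  baseChangeLin_tmul B P b₁ b₂ m₁ m₂

end Pairing

end

end GL2Pairing

namespace GL2Pairing

open Matrix

/-! ### Powers of unipotent elements -/

/-! Put K = U₁(ϖᶜ), with c ≥ 1 the common conductor of π₁ and π₂. The argument is that an invariant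
pairing is determined, up to the factor q - 1, by its value on the two newforms, by a formula that
is the same over A, B and ℂ.

Since c ≥ 1, the elements of K with determinant 1 mod ϖ are upper unipotent mod ϖ and form a pro-p
group, while the determinant mod ϖ takes at most q - 1 values. Every open subgroup therefore has
index in K dividing (q - 1)pᴺ (`relIndex_U1_dvd`). The trace to K of a translate g v₁ is fixed by K,
so it is an A-multiple of v₁. It is also congruent to the index times g v₁ modulo the span of the k
m - m, k ∈ K. As p is invertible in A, this gives (q - 1) g v₁ ≡ a(g) v₁ with a(g) ∈ A
(`IsModel.exists_sub_mem_augmentation`).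

Pairing with the K-fixed vector v₂ kills that span, whence (q - 1) P(g v₁, v₂) = a(g) P(v₁, v₂) over
any of the three rings. Over ℂ, averaging shows P(v₁, v₂) ≠ 0, so P can be rescaled to take the
value q - 1 there. Its values on translates are then the a(g), so it is A-valued on the lattices:
this is 𝒫₀. Over B the same identity compares any pairing with 𝒫₀ ⊗ B. -/

theorem exists_one_add_mul_pow_prime_pow {S : Type*} [Ring S] {p : ℕ} (hp : p.Prime) (r : S)
    (n : ℕ) : ∃ s : S, (1 + (p : S) * r) ^ p ^ n = 1 + (p : S) ^ (n + 1) * s := by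
  induction n with
  | zero => exact ⟨r, by simp⟩
  | succ n ih =>
    obtain ⟨s, hs⟩ := ih
    obtain ⟨t, ht⟩ := (Commute.one_left ((p : S) ^ (n + 1) * s)).exists_add_pow_prime_eq hp
    have hc : Commute ((p : S) ^ (n + 1)) s := (Nat.cast_commute p s).pow_left _
    obtain ⟨k, hk⟩ : ∃ k, (n + 1) * p = (n + 1 + 1) + k :=
      Nat.exists_eq_add_of_le (by nlinarith [hp.two_le])
    -- The first summand comes from the p-th power of p ^ (n + 1) * s, as (n + 1)p ≥ n + 2; the
    -- second from the mixed binomial terms, which carry a further factor p.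
    refine ⟨(p : S) ^ k * s ^ p + s * t, ?_⟩
    rw [pow_succ, pow_mul, hs, ht, hc.mul_pow, ← pow_mul, hk, pow_add _ (n + 1 + 1) k,
      pow_succ' (p : S) (n + 1)]
    simp only [one_pow]
    noncomm_ring

/-- If `p` and `X` are nilpotent, then `1 + X` has `p`-power order. -/
theorem exists_one_add_pow_prime_pow_eq_one {S : Type*} [Ring S] {p : ℕ} (hp : p.Prime)
    (hpS : IsNilpotent (p : S)) {X : S} (hX : IsNilpotent X) : ∃ j : ℕ, (1 + X) ^ p ^ j = 1 := by
  obtain ⟨a, ha⟩ := hX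
  obtain ⟨b, hb⟩ := hpS
  -- The p ^ a-th power removes X up to a multiple of p; a further p ^ b-th power pushes that
  -- multiple into p ^ (b + 1) S = 0.
  obtain ⟨r, hr⟩ := (Commute.one_left X).exists_add_pow_prime_pow_eq hp a
  obtain ⟨s, hs⟩ := exists_one_add_mul_pow_prime_pow hp (X * r) b
  refine ⟨a + b, ?_⟩
  have h1 : X ^ p ^ a = 0 := pow_eq_zero_of_le (Nat.lt_pow_self hp.one_lt).le ha
  rw [pow_add, pow_mul, hr, h1]
  simp only [one_pow, add_zero, mul_one, mul_assoc]
  rw [hs, pow_succ, hb]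
  simp

/-- By Cayley–Hamilton, X² = tr(X) X - det(X), and the trace and determinant are nilpotent scalars.
-/
theorem isNilpotent_of_entries {R : Type*} [CommRing R] (X : Matrix (Fin 2) (Fin 2) R)
    (h00 : IsNilpotent (X 0 0)) (h10 : IsNilpotent (X 1 0)) (h11 : IsNilpotent (X 1 1)) :
    IsNilpotent X := by
  have ht : IsNilpotent (X 0 0 + X 1 1) := (Commute.all _ _).isNilpotent_add h00 h11
  have hd : IsNilpotent (X 0 0 * X 1 1 - X 0 1 * X 1 0) :=
    (Commute.all _ _).isNilpotent_sub ((Commute.all _ _).isNilpotent_mul_left h11)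
      ((Commute.all _ _).isNilpotent_mul_left h10)
  have hX : X ^ 2 = (algebraMap R (Matrix (Fin 2) (Fin 2) R) (X 0 0 + X 1 1)) * X
      - algebraMap R (Matrix (Fin 2) (Fin 2) R) (X 0 0 * X 1 1 - X 0 1 * X 1 0) := by
    ext i j
    rw [← Algebra.smul_def]
    fin_cases i <;> fin_cases j <;>
      simp [pow_two, Matrix.mul_apply, Fin.sum_univ_two, Matrix.algebraMap_matrix_apply] <;> ring
  have h2 : IsNilpotent (X ^ 2) := by
    rw [hX]
    refine Commute.isNilpotent_sub ?_ ?_ (hd.map (algebraMap R (Matrix (Fin 2) (Fin 2) R)))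
    · exact (Algebra.commutes _ _ : _)|>.symm
    · exact Commute.isNilpotent_mul_right (Algebra.commutes _ _)
        (ht.map (algebraMap R (Matrix (Fin 2) (Fin 2) R)))
  exact IsNilpotent.of_pow h2

/-! ### Indices of open subgroups in congruence subgroups of GL₂(R) -/

section Index

variable {R : Type*} [CommRing R]

/-- The determinant modulo `I`. -/
def detMod (I : Ideal R) : GL (Fin 2) R →* (R ⧸ I)ˣ :=
  (Units.map (Ideal.Quotient.mk I).toMonoidHom).comp Matrix.GeneralLinearGroup.det

theorem U1Ideal_mono {I J : Ideal R} (h : I ≤ J) : U1Ideal I ≤ U1Ideal J :=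
  fun _ hg => ⟨h hg.1, h hg.2⟩

/-- The principal congruence subgroup of level `I`. -/
def principalCongruence (I : Ideal R) : Subgroup (GL (Fin 2) R) :=
  (Matrix.GeneralLinearGroup.map (Ideal.Quotient.mk I)).ker

theorem mem_principalCongruence {I : Ideal R} {g : GL (Fin 2) R} :
    g ∈ principalCongruence I ↔ ∀ i j, g.val i j - (1 : Matrix (Fin 2) (Fin 2) R) i j ∈ I := by
  rw [principalCongruence, MonoidHom.mem_ker, Units.ext_iff, ← Matrix.ext_iff]
  refine forall₂_congr fun i j => ?_
  rw [← Ideal.Quotient.mk_eq_mk_iff_sub_mem]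
  have : (Ideal.Quotient.mk I) ((1 : Matrix (Fin 2) (Fin 2) R) i j)
      = (1 : Matrix (Fin 2) (Fin 2) (R ⧸ I)) i j := by
    rw [Matrix.one_apply, Matrix.one_apply]; split_ifs <;> simp
  rw [this]
  rfl

/-- Modulo I such a g is upper unipotent, so modulo Iᵏ both g - 1 and p are nilpotent and g has
p-power order. -/
theorem exists_pow_mem_principalCongruence {p : ℕ} (hp : p.Prime) {I : Ideal R}
    (hpI : (p : R) ∈ I) {g : GL (Fin 2) R} (hg : g ∈ U1Ideal I) (hg' : g ∈ (detMod I).ker)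
    (k : ℕ) : ∃ j : ℕ, g ^ p ^ j ∈ principalCongruence (I ^ k) := by
  set f := Ideal.Quotient.mk (I ^ k)
  have hnil : ∀ x ∈ I, IsNilpotent (f x) := fun x hx =>
    ⟨k, by rw [← map_pow]; exact Ideal.Quotient.eq_zero_iff_mem.mpr (Ideal.pow_mem_pow hx k)⟩
  have hdet : g.val 0 0 * g.val 1 1 - g.val 0 1 * g.val 1 0 - 1 ∈ I := by
    have := congrArg Units.val (MonoidHom.mem_ker.mp hg')
    rw [← Matrix.det_fin_two, ← Ideal.Quotient.mk_eq_mk_iff_sub_mem, map_one]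
    exact this
  have h00 : g.val 0 0 - 1 ∈ I := by
    have e : g.val 0 0 - 1 = (g.val 0 0 * g.val 1 1 - g.val 0 1 * g.val 1 0 - 1)
        - g.val 0 0 * (g.val 1 1 - 1) + g.val 0 1 * g.val 1 0 := by ring
    rw [e]
    exact I.add_mem (I.sub_mem hdet (I.mul_mem_left _ hg.2)) (I.mul_mem_left _ hg.1)
  have hX : IsNilpotent ((g.val - 1).map f) := by
    refine isNilpotent_of_entries _ ?_ ?_ ?_
    · simpa using hnil _ h00
    · simpa using hnil _ hg.1
    · simpa using hnil _ hg.2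
  have hp' : IsNilpotent ((p : ℕ) : Matrix (Fin 2) (Fin 2) (R ⧸ I ^ k)) := by
    have := (hnil _ hpI).map (algebraMap (R ⧸ I ^ k) (Matrix (Fin 2) (Fin 2) (R ⧸ I ^ k)))
    simpa using this
  obtain ⟨j, hj⟩ := exists_one_add_pow_prime_pow_eq_one hp hp' hX
  refine ⟨j, ?_⟩
  rw [principalCongruence, MonoidHom.mem_ker, map_pow, Units.ext_iff, Units.val_pow_eq_pow_val,
    Units.val_one, ← hj]
  congr 1
  ext i l
  have : f ((1 : Matrix (Fin 2) (Fin 2) R) i l)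
      = (1 : Matrix (Fin 2) (Fin 2) (R ⧸ I ^ k)) i l := by
    rw [Matrix.one_apply, Matrix.one_apply]; split_ifs <;> simp
  simp [f] at this ⊢
  rw [this]
  ring

variable [TopologicalSpace R]

theorem continuous_GL_entry (i j : Fin 2) : Continuous fun g : GL (Fin 2) R => g.val i j :=
  Units.continuous_val.matrix_elem i j

variable [IsTopologicalRing R] [CompactSpace R] [T2Space R]

theorem compactSpace_GL : CompactSpace (GL (Fin 2) R) := by
  have : CompactSpace (Matrix (Fin 2) (Fin 2) R) :=
    inferInstanceAs (CompactSpace (Fin 2 → Fin 2 → R))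
  have : T2Space (Matrix (Fin 2) (Fin 2) R) :=
    inferInstanceAs (T2Space (Fin 2 → Fin 2 → R))
  infer_instance

variable [IsNoetherianRing R]

theorem isClosed_principalCongruence (I : Ideal R) :
    IsClosed (principalCongruence I : Set (GL (Fin 2) R)) := by
  have : (principalCongruence I : Set (GL (Fin 2) R)) = ⋂ i, ⋂ j,
      (fun g : GL (Fin 2) R => g.val i j - (1 : Matrix (Fin 2) (Fin 2) R) i j) ⁻¹' (I : Set R) := by
    ext g
    simp [mem_principalCongruence]
  rw [this]
  exact isClosed_iInter fun i => isClosed_iInter fun j =>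
    (IsNoetherianRing.isClosed_ideal I).preimage ((continuous_GL_entry i j).sub continuous_const)

theorem isClosed_U1Ideal (I : Ideal R) : IsClosed (U1Ideal I : Set (GL (Fin 2) R)) :=
  ((IsNoetherianRing.isClosed_ideal I).preimage (continuous_GL_entry 1 0)).inter
    ((IsNoetherianRing.isClosed_ideal I).preimage ((continuous_GL_entry 1 1).sub continuous_const))

/-- Compactness: the groups on the left are closed and decreasing, and meet only in 1 by Krull's
intersection theorem. -/
theorem exists_principalCongruence_le [IsLocalRing R] {I : Ideal R} (hI : I ≠ ⊤)
    {N : Subgroup (GL (Fin 2) R)} (hN : IsOpen (N : Set (GL (Fin 2) R))) :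
    ∃ k : ℕ, principalCongruence (I ^ k) ≤ N := by
  have := compactSpace_GL (R := R)
  refine exists_subset_nhds_of_compactSpace
    (V := fun k : ℕ => (principalCongruence (I ^ k) : Set (GL (Fin 2) R))) ?_
    (fun k => isClosed_principalCongruence _) ?_
  · refine directed_of_isDirected_le fun m n hmn g hg => ?_
    rw [SetLike.mem_coe, mem_principalCongruence] at hg ⊢
    exact fun i j => Ideal.pow_le_pow_right hmn (hg i j)
  · intro g hg
    have : g = 1 := by
      rw [Units.ext_iff, ← Matrix.ext_iff]
      intro i j
      rw [Set.mem_iInter] at hg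
      have h : g.val i j - (1 : Matrix (Fin 2) (Fin 2) R) i j ∈ ⨅ k, I ^ k := by
        rw [Submodule.mem_iInf]
        exact fun k => mem_principalCongruence.mp (hg k) i j
      rw [Ideal.iInf_pow_eq_bot_of_isLocalRing I hI] at h
      exact sub_eq_zero.mp h
    rw [this]
    exact hN.mem_nhds N.one_mem

/-- An open subgroup of `GL₂(R)` has index dividing `(q - 1) p ^ N` in `U₁(𝔪ⁿ)`, `n ≥ 1`. -/
theorem relIndex_U1Ideal_dvd [IsLocalRing R] {p : ℕ} (hp : p.Prime)
    (hpR : (p : R) ∈ IsLocalRing.maximalIdeal R) [Finite (IsLocalRing.ResidueField R)] {n : ℕ}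
    (hn : 1 ≤ n) {L : Subgroup (GL (Fin 2) R)} (hL : IsOpen (L : Set (GL (Fin 2) R))) :
    ∃ N : ℕ, L.relIndex (U1Ideal (IsLocalRing.maximalIdeal R ^ n)) ∣
      (Nat.card (IsLocalRing.ResidueField R) - 1) * p ^ N := by
  classical
  have := Fact.mk hp
  have := compactSpace_GL (R := R)
  have := Subgroup.quotient_finite_of_isOpen L hL
  have : L.FiniteIndex := Subgroup.finiteIndex_of_finite_quotient
  set I := IsLocalRing.maximalIdeal R
  set K := U1Ideal (I ^ n)
  set C := (detMod I).ker
  -- Passing to the normal core makes the quotient a group, whose order can be read off from the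
  -- orders of its elements.
  have hcore : IsOpen (L.normalCore : Set (GL (Fin 2) R)) :=
    Subgroup.isOpen_of_isClosed_of_finiteIndex _
      (L.normalCore_isClosed (Subgroup.isClosed_of_isOpen L hL))
  obtain ⟨k, hk⟩ := exists_principalCongruence_le
    (IsLocalRing.maximalIdeal.isMaximal R).ne_top hcore
  have hpg : IsPGroup p (↥(C ⊓ K) ⧸ L.normalCore.subgroupOf (C ⊓ K)) := by
    intro x
    obtain ⟨g, rfl⟩ := QuotientGroup.mk_surjective x
    obtain ⟨j, hj⟩ := exists_pow_mem_principalCongruence hp hpR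
      (U1Ideal_mono (Ideal.pow_le_self (by omega)) g.2.2) g.2.1 k
    refine ⟨j, ?_⟩
    rw [← QuotientGroup.mk_pow, QuotientGroup.eq_one_iff, Subgroup.mem_subgroupOf]
    simpa using hk hj
  have : Finite (↥(C ⊓ K) ⧸ L.normalCore.subgroupOf (C ⊓ K)) :=
    Subgroup.finite_quotient_of_finiteIndex
  obtain ⟨N, hN⟩ := IsPGroup.iff_card.mp hpg
  refine ⟨N, ?_⟩
  have h1 : L.relIndex (C ⊓ K) ∣ p ^ N := by
    rw [← hN]
    exact Subgroup.relIndex_dvd_of_le_left _ L.normalCore_le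
  have h2 : C.relIndex K ∣ Nat.card (IsLocalRing.ResidueField R) - 1 := by
    refine (Subgroup.relIndex_dvd_index_of_normal C K).trans ?_
    rw [Subgroup.index_ker]
    refine (Subgroup.card_subgroup_dvd_card _).trans ?_
    let _ : Field (R ⧸ IsLocalRing.maximalIdeal R) := Ideal.Quotient.field _
    have : Finite (R ⧸ IsLocalRing.maximalIdeal R) := inferInstanceAs (Finite (IsLocalRing.ResidueField R))
    exact (Nat.card_units (R ⧸ IsLocalRing.maximalIdeal R)).dvd
  rw [mul_comm]
  -- The index is split along L ∩ C ∩ K ≤ C ∩ K ≤ K: a p-power times a divisor of q - 1.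
  refine (Subgroup.relIndex_dvd_of_le_left K (inf_le_left : L ⊓ C ≤ L)).trans ?_
  rw [← Subgroup.relIndex_inf_mul_relIndex]
  exact mul_dvd_mul h1 h2

end Index

/-! ### `U₁(ϖⁿ)` in `GL₂(F)` -/

section LocalField

open ValuativeRel

variable (F : Type*) [Field F] [ValuativeRel F] [TopologicalSpace F]

theorem continuous_GL_map :
    Continuous (Matrix.GeneralLinearGroup.map (n := Fin 2) (algebraMap 𝒪[F] F)) := by
  refine Continuous.units_map _ ?_
  exact Continuous.matrix_map continuous_id continuous_subtype_val

variable [IsNonarchimedeanLocalField F]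

theorem t2Space_localField : T2Space F := by
  let := IsTopologicalAddGroup.rightUniformSpace F
  have := isUniformAddGroup_of_addCommGroup (G := F)
  infer_instance

theorem isCompact_U1 (n : ℕ) : IsCompact (U1 F n : Set (GL (Fin 2) F)) := by
  have := t2Space_localField F
  have := compactSpace_GL (R := 𝒪[F])
  exact (isClosed_U1Ideal (𝓂[F] ^ n)).isCompact.image (continuous_GL_map F)

theorem isOpen_U1 (n : ℕ) : IsOpen (U1 F n : Set (GL (Fin 2) F)) := by
  obtain ⟨ϖ, hϖ⟩ := IsDiscreteValuationRing.exists_irreducible 𝒪[F]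
  have hϖ0 : (ϖ : F) ≠ 0 := by simpa using hϖ.ne_zero
  -- Congruences modulo ϖⁿ are rewritten as integrality conditions, which are open. Integrality of
  -- both g and g⁻¹ puts g in GL₂(𝒪).
  have hmem : ∀ x : 𝒪[F], (ϖ : F)⁻¹ ^ n * x ∈ 𝒪[F] → x ∈ 𝓂[F] ^ n := by
    intro x hx
    rw [hϖ.maximalIdeal_eq, Ideal.span_singleton_pow, Ideal.mem_span_singleton]
    refine ⟨⟨_, hx⟩, Subtype.ext ?_⟩
    simp [hϖ0]
  have hcont : ∀ i j, Continuous fun g : GL (Fin 2) F => g.val i j :=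
    continuous_GL_entry
  have hcont' : ∀ i j, Continuous fun g : GL (Fin 2) F => (g⁻¹).val i j := fun i j =>
    (continuous_GL_entry i j).comp continuous_inv
  have hO : IsOpen {x : F | x ∈ 𝒪[F]} := Valuation.isOpen_integer (v := valuation F)
  let W : Set (GL (Fin 2) F) :=
    (⋂ i, ⋂ j, (fun g : GL (Fin 2) F => g.val i j) ⁻¹' {x : F | x ∈ 𝒪[F]}) ∩
    (⋂ i, ⋂ j, (fun g : GL (Fin 2) F => (g⁻¹).val i j) ⁻¹' {x : F | x ∈ 𝒪[F]}) ∩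
    ((fun g : GL (Fin 2) F => (ϖ : F)⁻¹ ^ n * g.val 1 0) ⁻¹' {x : F | x ∈ 𝒪[F]} ∩
    (fun g : GL (Fin 2) F => (ϖ : F)⁻¹ ^ n * (g.val 1 1 - 1)) ⁻¹' {x : F | x ∈ 𝒪[F]})
  have hW : IsOpen W := by
    refine ((isOpen_iInter_of_finite fun i => isOpen_iInter_of_finite fun j =>
      hO.preimage (hcont i j)).inter (isOpen_iInter_of_finite fun i =>
        isOpen_iInter_of_finite fun j => hO.preimage (hcont' i j))).inter ?_
    exact (hO.preimage (continuous_const.mul (hcont 1 0))).inter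
      (hO.preimage (continuous_const.mul ((hcont 1 1).sub continuous_const)))
  have h1 : (1 : GL (Fin 2) F) ∈ W := by
    have h : ∀ i j, (1 : Matrix (Fin 2) (Fin 2) F) i j ∈ 𝒪[F] := fun i j => by
      rw [Matrix.one_apply]; split_ifs
      · exact one_mem _
      · exact zero_mem _
    refine ⟨⟨?_, ?_⟩, ?_, ?_⟩
    · exact Set.mem_iInter.2 fun i => Set.mem_iInter.2 fun j => h i j
    · refine Set.mem_iInter.2 fun i => Set.mem_iInter.2 fun j => ?_
      change (1⁻¹ : GL (Fin 2) F).val i j ∈ 𝒪[F]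
      rw [inv_one]
      exact h i j
    · simp
    · simp
  refine Subgroup.isOpen_of_mem_nhds (g := 1) _ (Filter.mem_of_superset (hW.mem_nhds h1) ?_)
  rintro g ⟨⟨h, h'⟩, h10, h11⟩
  simp only [Set.mem_iInter, Set.mem_preimage, Set.mem_ofPred_eq] at h h' h10 h11
  let a : Matrix (Fin 2) (Fin 2) 𝒪[F] := fun i j => ⟨g.val i j, h i j⟩
  let b : Matrix (Fin 2) (Fin 2) 𝒪[F] := fun i j => ⟨(g⁻¹).val i j, h' i j⟩
  have hinj : Function.Injective ((algebraMap 𝒪[F] F).mapMatrix (m := Fin 2)) :=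
    Matrix.map_injective Subtype.val_injective
  have ha : (algebraMap 𝒪[F] F).mapMatrix a = g.val := rfl
  have hb : (algebraMap 𝒪[F] F).mapMatrix b = (g⁻¹).val := rfl
  let γ : GL (Fin 2) 𝒪[F] := ⟨a, b, hinj (by rw [map_mul, map_one, ha, hb]; exact g.mul_inv),
    hinj (by rw [map_mul, map_one, ha, hb]; exact g.inv_mul)⟩
  refine ⟨γ, ⟨hmem _ h10, hmem _ ?_⟩, Units.ext ha⟩
  exact h11

theorem relIndex_U1_ne_zero (n : ℕ) {L : Subgroup (GL (Fin 2) F)}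
    (hL : IsOpen (L : Set (GL (Fin 2) F))) : L.relIndex (U1 F n) ≠ 0 := by
  have := t2Space_localField F
  have := compactSpace_GL (R := 𝒪[F])
  rw [U1, ← Subgroup.relIndex_comap]
  have := Subgroup.quotient_finite_of_isOpen (L.comap (Matrix.GeneralLinearGroup.map
    (algebraMap 𝒪[F] F))) (hL.preimage (continuous_GL_map F))
  have : (L.comap (Matrix.GeneralLinearGroup.map (n := Fin 2)
    (algebraMap 𝒪[F] F))).FiniteIndex := Subgroup.finiteIndex_of_finite_quotient
  exact fun h => Subgroup.FiniteIndex.index_ne_zero (Subgroup.index_eq_zero_of_relIndex_eq_zero h)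

theorem relIndex_U1_dvd {p : ℕ} [CharP 𝓀[F] p] {n : ℕ} (hn : 1 ≤ n) {L : Subgroup (GL (Fin 2) F)}
    (hL : IsOpen (L : Set (GL (Fin 2) F))) :
    ∃ N : ℕ, L.relIndex (U1 F n) ∣ (Nat.card 𝓀[F] - 1) * p ^ N := by
  have hp : p.Prime := CharP.char_is_prime 𝓀[F] p
  have hpm : (p : 𝒪[F]) ∈ 𝓂[F] := by
    rw [← IsLocalRing.residue_eq_zero_iff, map_natCast]
    exact CharP.cast_eq_zero _ _
  have := t2Space_localField F
  rw [U1, ← Subgroup.relIndex_comap]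
  exact relIndex_U1Ideal_dvd hp hpm hn (hL.preimage (continuous_GL_map F))

end LocalField

end GL2Pairing

namespace GL2Pairing

open Representation

/-! ### Traces to a subgroup -/

section Trace

variable {R G M : Type*} [CommRing R] [Group G] [AddCommGroup M] [Module R M]
  (ρ : Representation R G M)

theorem mem_fixedVectors {H : Subgroup G} {v : M} :
    v ∈ fixedVectors ρ H ↔ ∀ h ∈ H, ρ h v = v := by
  simp [fixedVectors, Representation.mem_invariants]

/-- The span of the vectors `ρ k m - m`, `k ∈ K`. -/
abbrev augmentation (K : Subgroup G) : Submodule R M := Coinvariants.ker (ρ.comp K.subtype)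

theorem sub_mem_augmentation {K : Subgroup G} {k : G} (hk : k ∈ K) (m : M) :
    ρ k m - m ∈ augmentation ρ K :=
  Coinvariants.sub_mem_ker (ρ := ρ.comp K.subtype) ⟨k, hk⟩ m

/-- A linear map that is invariant under `K` vanishes on the augmentation submodule. -/
theorem eq_zero_of_mem_augmentation {X : Type*} [AddCommGroup X] [Module R X] {K : Subgroup G}
    (f : M →ₗ[R] X) (hf : ∀ k ∈ K, ∀ m, f (ρ k m) = f m) {m : M} (hm : m ∈ augmentation ρ K) :
    f m = 0 := by
  have : augmentation ρ K ≤ LinearMap.ker f := by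
    refine Submodule.span_le.2 ?_
    rintro _ ⟨⟨k, m⟩, rfl⟩
    simpa [sub_eq_zero] using hf k k.2 m
  exact this hm

/-- The sum of the translates of `w` by representatives of `K / (K ∩ H)`. -/
noncomputable def relTrace (K H : Subgroup G) (w : M) : M :=
  ∑ᶠ x : K ⧸ H.subgroupOf K, ρ (x.out : K) w

/-- On an H-fixed vector the translate depends only on the coset, and K permutes the cosets. -/
theorem relTrace_mem_fixedVectors {K H : Subgroup G} (hKH : H.relIndex K ≠ 0) {w : M}
    (hw : w ∈ fixedVectors ρ H) : relTrace ρ K H w ∈ fixedVectors ρ K := by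
  have : (H.subgroupOf K).FiniteIndex := ⟨hKH⟩
  have := Fintype.ofFinite (K ⧸ H.subgroupOf K)
  have key : ∀ (x : K ⧸ H.subgroupOf K) (k : K), (k : K ⧸ H.subgroupOf K) = x →
      ρ (x.out : K) w = ρ k w := by
    intro x k hk
    have h : (k⁻¹ * x.out : K) ∈ H.subgroupOf K := by
      rw [← QuotientGroup.eq, hk, QuotientGroup.out_eq']
    have h' := (mem_fixedVectors ρ).1 hw _ h
    have e : ((x.out : K) : G) = k * ((k⁻¹ * x.out : K) : G) := by simp
    rw [e, map_mul, Module.End.mul_apply]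
    exact congrArg _ h'
  rw [mem_fixedVectors]
  intro k hk
  rw [relTrace, finsum_eq_sum_of_fintype, map_sum]
  rw [← Equiv.sum_comp (MulAction.toPerm (⟨k, hk⟩ : K))
    (fun x : K ⧸ H.subgroupOf K => ρ (x.out : K) w)]
  refine Finset.sum_congr rfl fun x _ => ?_
  rw [key (MulAction.toPerm (⟨k, hk⟩ : K) x) (⟨k, hk⟩ * x.out)]
  · simp
  · rw [MulAction.toPerm_apply]
    conv_rhs => rw [← QuotientGroup.out_eq' x]
    rfl

/-- Each translate of w is congruent to w, whatever representatives are chosen, so w need not be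
fixed by H. -/
theorem relTrace_sub_mem_augmentation {K H : Subgroup G} (hKH : H.relIndex K ≠ 0) (w : M) :
    relTrace ρ K H w - (H.relIndex K : R) • w ∈ augmentation ρ K := by
  have : (H.subgroupOf K).FiniteIndex := ⟨hKH⟩
  have := Fintype.ofFinite (K ⧸ H.subgroupOf K)
  have e : (H.relIndex K : R) • w = ∑ _x : K ⧸ H.subgroupOf K, w := by
    rw [Finset.sum_const, Finset.card_univ, ← Nat.card_eq_fintype_card, Nat.cast_smul_eq_nsmul]
    rfl
  rw [relTrace, finsum_eq_sum_of_fintype, e, ← Finset.sum_sub_distrib]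
  exact Submodule.sum_mem _ fun x _ => sub_mem_augmentation ρ x.out.2 w

theorem relTrace_smul {K H : Subgroup G} (hKH : H.relIndex K ≠ 0) (a : R) (w : M) :
    relTrace ρ K H (a • w) = a • relTrace ρ K H w := by
  have : (H.subgroupOf K).FiniteIndex := ⟨hKH⟩
  have := Fintype.ofFinite (K ⧸ H.subgroupOf K)
  simp [relTrace, finsum_eq_sum_of_fintype, Finset.smul_sum]

end Trace

/-! ### Invariant pairings -/

section Pairing

variable {R G M₁ M₂ : Type*} [CommRing R] [Group G] [AddCommGroup M₁] [Module R M₁]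
  [AddCommGroup M₂] [Module R M₂] {σ₁ : Representation R G M₁} {σ₂ : Representation R G M₂}

theorem InvPairing.apply_tmul (P : InvPairing σ₁ σ₂) (g : G) (m₁ : M₁) (m₂ : M₂) :
    P (σ₁ g m₁ ⊗ₜ σ₂ g m₂) = P (m₁ ⊗ₜ[R] m₂) := by
  have h := LinearMap.congr_fun (P.isIntertwining' g) (m₁ ⊗ₜ[R] m₂)
  simpa [Representation.tprod_apply] using h

theorem InvPairing.apply_tmul_eq (P : InvPairing σ₁ σ₂) (g h : G) (m₁ : M₁) (m₂ : M₂) :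
    P (σ₁ g m₁ ⊗ₜ σ₂ h m₂) = P (σ₁ (h⁻¹ * g) m₁ ⊗ₜ[R] m₂) := by
  rw [← P.apply_tmul h⁻¹ (σ₁ g m₁)]
  simp

/-- Evaluation of a pairing in its second variable. -/
noncomputable def InvPairing.evalRight (P : InvPairing σ₁ σ₂) (m₂ : M₂) : M₁ →ₗ[R] R :=
  P.toLinearMap ∘ₗ (TensorProduct.mk R M₁ M₂).flip m₂

@[simp]
theorem InvPairing.evalRight_apply (P : InvPairing σ₁ σ₂) (m₁ : M₁) (m₂ : M₂) :
    P.evalRight m₂ m₁ = P (m₁ ⊗ₜ[R] m₂) := rfl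

theorem InvPairing.evalRight_invariant (P : InvPairing σ₁ σ₂) {K : Subgroup G} {m₂ : M₂}
    (hm₂ : m₂ ∈ fixedVectors σ₂ K) : ∀ k ∈ K, ∀ m, P.evalRight m₂ (σ₁ k m) = P.evalRight m₂ m := by
  intro k hk m
  conv_lhs => rw [← (mem_fixedVectors σ₂).1 hm₂ k hk]
  exact P.apply_tmul k m m₂

/-- Two pairings agree if they agree on the translates of generators. -/
theorem InvPairing.ext_of_span {P Q : InvPairing σ₁ σ₂} {v₁ : M₁} {v₂ : M₂}
    (h₁ : Submodule.span R (Set.range fun g => σ₁ g v₁) = ⊤)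
    (h₂ : Submodule.span R (Set.range fun g => σ₂ g v₂) = ⊤)
    (h : ∀ g, P (σ₁ g v₁ ⊗ₜ[R] v₂) = Q (σ₁ g v₁ ⊗ₜ[R] v₂)) : P = Q := by
  have e : ∀ m₁ m₂, P (m₁ ⊗ₜ[R] m₂) = Q (m₁ ⊗ₜ[R] m₂) := by
    intro m₁ m₂
    have hm₁ : m₁ ∈ Submodule.span R (Set.range fun g => σ₁ g v₁) := h₁ ▸ Submodule.mem_top
    have hm₂ : m₂ ∈ Submodule.span R (Set.range fun g => σ₂ g v₂) := h₂ ▸ Submodule.mem_top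
    induction hm₂ using Submodule.span_induction with
    | mem x hx =>
      obtain ⟨k, rfl⟩ := hx
      induction hm₁ using Submodule.span_induction with
      | mem y hy =>
        obtain ⟨g, rfl⟩ := hy
        simp only
        rw [P.apply_tmul_eq, Q.apply_tmul_eq, h]
      | zero => simp
      | add y z _ _ hy hz => simp only [TensorProduct.add_tmul, map_add, hy, hz]
      | smul a y _ hy => simp only [← TensorProduct.smul_tmul', map_smul, hy]
    | zero => simp
    | add y z _ _ hy hz => simp only [TensorProduct.tmul_add, map_add, hy, hz]
    | smul a y _ hy => simp only [TensorProduct.tmul_smul, map_smul, hy]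
  apply Representation.IntertwiningMap.ext
  ext m₁ m₂
  exact e m₁ m₂

end Pairing

end GL2Pairing

namespace GL2Pairing

open Representation

/-! ### Nondegeneracy of pairings of irreducible representations -/

section Irreducible

variable {k G V : Type*} [Field k] [Group G] [AddCommGroup V] [Module k V]
  {ρ : Representation k G V}

theorem span_orbit_eq_top (hρ : ρ.IsIrreducible) {v : V} (hv : v ≠ 0) :
    Submodule.span k (Set.range fun g => ρ g v) = ⊤ := by
  let W : Subrepresentation ρ :=
    { toSubmodule := Submodule.span k (Set.range fun g => ρ g v)
      apply_mem_toSubmodule := fun g w hw => by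
        induction hw using Submodule.span_induction with
        | mem x hx =>
          obtain ⟨h, rfl⟩ := hx
          exact Submodule.subset_span ⟨g * h, by simp⟩
        | zero => simp
        | add x y _ _ hx hy => rw [map_add]; exact Submodule.add_mem _ hx hy
        | smul a x _ hx => rw [map_smul]; exact Submodule.smul_mem _ _ hx }
  have hvW : v ∈ W.toSubmodule := Submodule.subset_span ⟨1, by simp⟩
  rcases hρ.eq_bot_or_eq_top W with h | h
  · rw [h] at hvW
    exact absurd hvW hv
  · exact congrArg Subrepresentation.toSubmodule h

theorem InvPairing.exists_apply_ne_zero {V' : Type*} [AddCommGroup V'] [Module k V']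
    {ρ' : Representation k G V'} {P : InvPairing ρ' ρ} (hP : P ≠ 0) (hρ : ρ.IsIrreducible) {v : V}
    (hv : v ≠ 0) : ∃ w, P (w ⊗ₜ[k] v) ≠ 0 := by
  by_contra! h
  refine hP (Representation.IntertwiningMap.ext (TensorProduct.ext' fun w x => ?_))
  change P (w ⊗ₜ[k] x) = 0
  have hx : x ∈ Submodule.span k (Set.range fun g => ρ g v) :=
    span_orbit_eq_top hρ hv ▸ Submodule.mem_top
  induction hx using Submodule.span_induction with
  | mem x hx =>
    obtain ⟨g, rfl⟩ := hx
    simpa [h] using P.apply_tmul_eq 1 g w v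
  | zero => simp
  | add y z _ _ hy hz => simp only [TensorProduct.tmul_add, map_add, hy, hz, add_zero]
  | smul a y _ hy => simp only [TensorProduct.tmul_smul, map_smul, hy, smul_zero]

/-- The pairing with the two variables exchanged. -/
noncomputable def InvPairing.swap {V' : Type*} [AddCommGroup V'] [Module k V']
    {ρ' : Representation k G V'} (P : InvPairing ρ' ρ) : InvPairing ρ ρ' where
  toLinearMap := P.toLinearMap ∘ₗ (TensorProduct.comm k V V').toLinearMap
  isIntertwining' g := by
    ext x y
    simpa using P.apply_tmul g y x

theorem InvPairing.swap_ne_zero {V' : Type*} [AddCommGroup V'] [Module k V']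
    {ρ' : Representation k G V'} {P : InvPairing ρ' ρ} (hP : P ≠ 0) : P.swap ≠ 0 := by
  intro h
  refine hP (Representation.IntertwiningMap.ext (TensorProduct.ext' fun x y => ?_))
  exact congrArg (fun Q : InvPairing ρ ρ' => Q (y ⊗ₜ[k] x)) h

end Irreducible

/-! ### Equality of conductors and nonvanishing on newforms -/

section Conductor

theorem IsNewform.mem {F : Type*} [Field F] [ValuativeRel F] {V : Type*} [AddCommGroup V] [Module ℂ V]
    {π : Representation ℂ (Matrix.GeneralLinearGroup (Fin 2) F) V} {v : V} (h : IsNewform π v) :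
    v ∈ fixedVectors π (U1 F (conductor π)) := by
  have : v ∈ newSpace π := h.2 ▸ Submodule.mem_span_singleton_self v
  exact this

variable {F : Type*} [Field F] [ValuativeRel F] [TopologicalSpace F]
  [IsNonarchimedeanLocalField F]
  {V₁ V₂ : Type*} [AddCommGroup V₁] [Module ℂ V₁] [AddCommGroup V₂] [Module ℂ V₂]
  {π₁ : Representation ℂ (Matrix.GeneralLinearGroup (Fin 2) F) V₁}
  {π₂ : Representation ℂ (Matrix.GeneralLinearGroup (Fin 2) F) V₂}

/-- Tracing w to U₁(ϖⁿ) multiplies its pairing with the fixed vector v by the index, which is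
nonzero in ℂ. -/
theorem InvPairing.exists_fixed_apply_ne_zero {P : InvPairing π₁ π₂} (hP : P ≠ 0)
    (smooth₁ : IsSmooth π₁) (irred₂ : π₂.IsIrreducible) {n : ℕ} {v : V₂} (hv : v ≠ 0)
    (hvn : v ∈ fixedVectors π₂ (U1 F n)) :
    ∃ w ∈ fixedVectors π₁ (U1 F n), P (w ⊗ₜ[ℂ] v) ≠ 0 := by
  obtain ⟨w, hw⟩ := P.exists_apply_ne_zero hP irred₂ hv
  obtain ⟨L, hL, hwL⟩ := smooth₁ w
  have hi := relIndex_U1_ne_zero F n hL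
  refine ⟨relTrace π₁ (U1 F n) L w, relTrace_mem_fixedVectors π₁ hi hwL, ?_⟩
  have h := eq_zero_of_mem_augmentation π₁ (P.evalRight v) (P.evalRight_invariant hvn)
    (relTrace_sub_mem_augmentation π₁ hi w)
  rw [map_sub, map_smul, sub_eq_zero, evalRight_apply, evalRight_apply] at h
  rw [h]
  exact smul_ne_zero (Nat.cast_ne_zero.2 hi) hw

theorem conductor_le_of_pairing {P : InvPairing π₁ π₂} (hP : P ≠ 0) (smooth₁ : IsSmooth π₁)
    (irred₂ : π₂.IsIrreducible) {v : V₂} (hv : IsNewform π₂ v) : conductor π₁ ≤ conductor π₂ := by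
  obtain ⟨w, hw, hw'⟩ := P.exists_fixed_apply_ne_zero hP smooth₁ irred₂ hv.1 hv.mem
  refine Nat.sInf_le (Submodule.ne_bot_iff _ |>.2 ⟨w, hw, ?_⟩)
  rintro rfl
  simp at hw'

theorem InvPairing.apply_newforms_ne_zero {P : InvPairing π₁ π₂} (hP : P ≠ 0)
    (smooth₁ : IsSmooth π₁) (irred₂ : π₂.IsIrreducible) (hc : conductor π₂ = conductor π₁)
    {v₁ : V₁} {v₂ : V₂} (h₁ : IsNewform π₁ v₁) (h₂ : IsNewform π₂ v₂) :
    P (v₁ ⊗ₜ[ℂ] v₂) ≠ 0 := by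
  obtain ⟨w, hw, hw'⟩ := P.exists_fixed_apply_ne_zero hP smooth₁ irred₂ h₂.1 h₂.mem
  rw [hc] at hw
  change w ∈ newSpace π₁ at hw
  rw [h₁.2, Submodule.mem_span_singleton] at hw
  obtain ⟨a, rfl⟩ := hw
  intro h
  rw [← TensorProduct.smul_tmul', map_smul, h, smul_zero] at hw'
  exact hw' rfl

end Conductor

/-! ### Fixed vectors and generators in a model -/

section Model

variable {G V : Type*} [Group G] [AddCommGroup V] [Module ℂ V] {A : Subring ℂ}
  {ρ : Representation ℂ G V} {M : Submodule A V}

@[simp]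
theorem restrictRep_apply_coe (hM : ∀ g : G, ∀ v ∈ M, ρ g v ∈ M) (g : G) (m : M) :
    (restrictRep ρ M hM g m : V) = ρ g m := rfl

theorem mem_fixedVectors_restrictRep {hM : ∀ g : G, ∀ v ∈ M, ρ g v ∈ M} {H : Subgroup G} {m : M} :
    m ∈ fixedVectors (restrictRep ρ M hM) H ↔ (m : V) ∈ fixedVectors ρ H := by
  simp only [mem_fixedVectors, Subtype.ext_iff, restrictRep_apply_coe]

theorem span_orbit_restrictRep_eq_top {hM : ∀ g : G, ∀ v ∈ M, ρ g v ∈ M} {v : M}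
    (h : Submodule.span A (Set.range fun g => ρ g (v : V)) = M) :
    Submodule.span A (Set.range fun g => restrictRep ρ M hM g v) = ⊤ := by
  apply Submodule.map_injective_of_injective M.subtype_injective
  rw [Submodule.map_span, Submodule.map_top, Submodule.range_subtype, ← Set.range_comp]
  exact h

/-- A line of fixed vectors of a compact open subgroup meets a model in a free module of rank
one. -/
theorem IsModel.exists_eq_span_singleton [TopologicalSpace G] [IsPrincipalIdealRing A]
    (model : IsModel A ρ M) {K : Subgroup G} (hK : IsOpen (K : Set G))
    (hK' : IsCompact (K : Set G)) {v : V} (hv : fixedVectors ρ K = Submodule.span ℂ {v}) :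
    ∃ u : M, (u : V) ∈ fixedVectors ρ K ∧
      ∀ w : M, (w : V) ∈ fixedVectors ρ K → ∃ a : A, w = a • u := by
  have := model.free K hK hK'
  set N := M ⊓ (fixedVectors ρ K).restrictScalars A
  let ι := Module.Free.ChooseBasisIndex A N
  let b : Module.Basis ι A N := Module.Free.chooseBasis A N
  -- By flatness of ℂ over A, an A-basis of the fixed lattice stays independent in M ⊗ ℂ ≅ V. Lying
  -- in a line, it has at most one element.
  have hli : LinearIndependent ℂ fun i => ((b i : N) : V) := by
    have h1 : LinearIndependent A fun i => Submodule.inclusion (inf_le_left : N ≤ M) (b i) :=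
      b.linearIndependent.map' _ (Submodule.ker_inclusion _ _ _)
    have h2 := (Module.Flat.linearIndependent_one_tmul (S := ℂ) h1).map'
      model.baseChange.equiv.toLinearMap (LinearEquiv.ker _)
    have e : (fun i => ((b i : N) : V)) = model.baseChange.equiv.toLinearMap ∘
        fun i => (1 : ℂ) ⊗ₜ[A] Submodule.inclusion (inf_le_left : N ≤ M) (b i) := by
      ext i
      simp [IsBaseChange.equiv_tmul]
    rw [e]
    exact h2
  have hsub : Subsingleton ι := by
    refine ⟨fun i j => ?_⟩
    by_contra hij
    have hmem : ∀ i, ∃ z : ℂ, z • v = ((b i : N) : V) := fun i => by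
      have : ((b i : N) : V) ∈ fixedVectors ρ K := (b i).2.2
      rwa [hv, Submodule.mem_span_singleton] at this
    obtain ⟨y, hy⟩ := hmem i
    obtain ⟨z, hz⟩ := hmem j
    have hpair : LinearIndependent ℂ ![((b i : N) : V), ((b j : N) : V)] := by
      have h := hli.comp ![i, j] (by
        intro k l
        fin_cases k <;> fin_cases l <;> simp [hij, Ne.symm hij])
      convert h using 1
      ext k
      fin_cases k <;> rfl
    have h := LinearIndependent.pair_iff.1 hpair z (-y)
      (by rw [← hy, ← hz, smul_smul, smul_smul, ← add_smul]; simp [mul_comm])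
    exact hli.ne_zero j (by rw [← hz, h.1, zero_smul])
  rcases isEmpty_or_nonempty ι with he | ⟨⟨i⟩⟩
  · have : Subsingleton N := b.repr.toEquiv.subsingleton
    refine ⟨0, by simp, fun w hw => ⟨0, ?_⟩⟩
    have := congrArg Subtype.val (Subsingleton.elim (⟨w, w.2, hw⟩ : N) 0)
    exact Subtype.ext (by simpa using this)
  · refine ⟨⟨b i, (b i).2.1⟩, (b i).2.2, fun w hw => ⟨b.repr ⟨w, w.2, hw⟩ i, ?_⟩⟩
    have : Unique ι := { default := i, uniq := fun j => Subsingleton.elim j i }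
    have h := b.sum_repr ⟨w, w.2, hw⟩
    rw [Fintype.sum_unique] at h
    have h' := congrArg Subtype.val h
    refine Subtype.ext ?_
    rw [Subsingleton.elim i default]
    exact h'.symm

end Model

/-! ### Translates of the newform modulo the augmentation -/

section Hecke

variable {F : Type*} [Field F] [ValuativeRel F] [TopologicalSpace F]
  [IsNonarchimedeanLocalField F] {V : Type*} [AddCommGroup V] [Module ℂ V] {A : Subring ℂ}
  [IsPrincipalIdealRing A]
  {π : Representation ℂ (Matrix.GeneralLinearGroup (Fin 2) F) V} {M : Submodule A V}

/-- Modulo the augmentation submodule of `U₁(ϖⁿ)`, each translate `g v` of a generator `v` of the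
line of fixed vectors becomes an `A`-multiple of `v` after multiplication by `q - 1`. -/
theorem IsModel.exists_sub_mem_augmentation {p : ℕ} [CharP 𝓀[F] p] (hp : IsUnit (p : A))
    (smooth : IsSmooth π) (model : IsModel A π M) {n : ℕ} (hn : 1 ≤ n) {v : M}
    (hv : fixedVectors π (U1 F n) = Submodule.span ℂ {(v : V)})
    (g : Matrix.GeneralLinearGroup (Fin 2) F) :
    ∃ a : A, ((Nat.card 𝓀[F] : A) - 1) • restrictRep π M model.stable g v - a • v ∈
      augmentation (restrictRep π M model.stable) (U1 F n) := by
  set σ := restrictRep π M model.stable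
  obtain ⟨u, hu, hgen⟩ := model.exists_eq_span_singleton (isOpen_U1 F n) (isCompact_U1 F n) hv
  obtain ⟨c, hc⟩ := hgen v (hv ▸ Submodule.mem_span_singleton_self _)
  -- The lattice generator u is traced rather than v, since v = c u need not generate the fixed
  -- lattice. If the trace of g u is s u, that of g v is c s u = s v, a multiple of v with no
  -- division by c.
  obtain ⟨L, hL, huL⟩ := smooth (σ g u : V)
  have huL' : σ g u ∈ fixedVectors σ L := mem_fixedVectors_restrictRep.2 huL
  have hi := relIndex_U1_ne_zero F n hL
  obtain ⟨N, m, hm⟩ := relIndex_U1_dvd F (p := p) hn hL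
  obtain ⟨s, hs⟩ := hgen (relTrace σ (U1 F n) L (σ g u))
    (mem_fixedVectors_restrictRep.1 (relTrace_mem_fixedVectors σ hi huL'))
  have htr : relTrace σ (U1 F n) L (σ g v) = s • v := by
    rw [hc, map_smul, relTrace_smul σ hi, hs, smul_comm]
  have haug := relTrace_sub_mem_augmentation σ hi (σ g v)
  rw [htr] at haug
  obtain ⟨r, hr⟩ := hp.exists_left_inv
  -- As p is a unit of A with inverse r, divisibility of (q - 1)pᴺ by the index becomes divisibility
  -- of q - 1 in A.
  have hq : (Nat.card 𝓀[F] : A) - 1 = r ^ N * m * (L.relIndex (U1 F n) : A) := by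
    have h1 : ((Nat.card 𝓀[F] - 1 : ℕ) : A) = (Nat.card 𝓀[F] : A) - 1 := by
      rw [Nat.cast_sub Nat.card_pos, Nat.cast_one]
    have h2 := congrArg (Nat.cast : ℕ → A) hm
    rw [Nat.cast_mul, Nat.cast_mul, Nat.cast_pow, h1] at h2
    calc (Nat.card 𝓀[F] : A) - 1 = (r * p) ^ N * ((Nat.card 𝓀[F] : A) - 1) := by rw [hr]; simp
      _ = r ^ N * (((Nat.card 𝓀[F] : A) - 1) * p ^ N) := by ring
      _ = _ := by rw [h2]; ring
  refine ⟨r ^ N * m * s, ?_⟩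
  have e : ((Nat.card 𝓀[F] : A) - 1) • σ g v - (r ^ N * m * s) • v
      = -(r ^ N * m) • (s • v - (L.relIndex (U1 F n) : A) • σ g v) := by
    rw [hq]
    module
  rw [e]
  exact Submodule.smul_mem _ _ haug

end Hecke

/-! ### Descent of a complex pairing to the lattices -/

section Restriction

variable {G V₁ V₂ : Type*} [Group G] [AddCommGroup V₁] [Module ℂ V₁] [AddCommGroup V₂]
  [Module ℂ V₂] {A : Subring ℂ} {π₁ : Representation ℂ G V₁} {π₂ : Representation ℂ G V₂}
  {M₁ : Submodule A V₁} {M₂ : Submodule A V₂}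
  (h₁ : ∀ g : G, ∀ v ∈ M₁, π₁ g v ∈ M₁) (h₂ : ∀ g : G, ∀ v ∈ M₂, π₂ g v ∈ M₂)

/-- A complex pairing that is `A`-valued on translates of generators restricts to an `A`-valued
pairing of the lattices. -/
theorem InvPairing.exists_restrict (P : InvPairing π₁ π₂) {v₁ : M₁} {v₂ : M₂}
    (gen₁ : Submodule.span A (Set.range fun g => π₁ g (v₁ : V₁)) = M₁)
    (gen₂ : Submodule.span A (Set.range fun g => π₂ g (v₂ : V₂)) = M₂)
    (hA : ∀ g, P (π₁ g v₁ ⊗ₜ[ℂ] (v₂ : V₂)) ∈ A) :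
    ∃ Q : InvPairing (restrictRep π₁ M₁ h₁) (restrictRep π₂ M₂ h₂),
      ∀ m₁ m₂, ((Q (m₁ ⊗ₜ[A] m₂) : A) : ℂ) = P ((m₁ : V₁) ⊗ₜ[ℂ] (m₂ : V₂)) := by
  have hsmul : ∀ (a : A) (x : V₁) (y : V₂), P ((a • x) ⊗ₜ[ℂ] y) = a * P (x ⊗ₜ[ℂ] y) := by
    intro a x y
    have : a • x = (a : ℂ) • x := rfl
    rw [this, ← TensorProduct.smul_tmul', map_smul, smul_eq_mul]
  have hsmul' : ∀ (a : A) (x : V₁) (y : V₂), P (x ⊗ₜ[ℂ] (a • y)) = a * P (x ⊗ₜ[ℂ] y) := by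
    intro a x y
    have : a • y = (a : ℂ) • y := rfl
    rw [this, TensorProduct.tmul_smul, map_smul, smul_eq_mul]
  have key : ∀ x ∈ M₁, ∀ y ∈ M₂, P (x ⊗ₜ[ℂ] y) ∈ A := by
    intro x hx y hy
    rw [← gen₂] at hy
    rw [← gen₁] at hx
    induction hy using Submodule.span_induction with
    | mem y hy =>
      obtain ⟨k, rfl⟩ := hy
      induction hx using Submodule.span_induction with
      | mem x hx =>
        obtain ⟨g, rfl⟩ := hx
        simp only
        rw [P.apply_tmul_eq]
        exact hA _
      | zero => simp
      | add y z _ _ hy hz =>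
        rw [TensorProduct.add_tmul, map_add]
        exact A.add_mem hy hz
      | smul a y _ hy =>
        rw [hsmul]
        exact A.mul_mem a.2 hy
    | zero => simp
    | add y z _ _ hy hz =>
      rw [TensorProduct.tmul_add, map_add]
      exact A.add_mem hy hz
    | smul a y _ hy =>
      rw [hsmul']
      exact A.mul_mem a.2 hy
  let β : M₁ →ₗ[A] M₂ →ₗ[A] A := LinearMap.mk₂ A
    (fun x y => ⟨P ((x : V₁) ⊗ₜ[ℂ] (y : V₂)), key x x.2 y y.2⟩)
    (fun x x' y => Subtype.ext (by simp [TensorProduct.add_tmul]))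
    (fun a x y => Subtype.ext (hsmul a _ _))
    (fun x y y' => Subtype.ext (by simp [TensorProduct.tmul_add]))
    (fun a x y => Subtype.ext (hsmul' a _ _))
  refine ⟨⟨TensorProduct.lift β, fun g => ?_⟩, fun m₁ m₂ => rfl⟩
  refine TensorProduct.ext' fun x y => Subtype.ext ?_
  exact P.apply_tmul g (x : V₁) (y : V₂)

end Restriction

/-! ### Fixed vectors and generators after base change -/

section BaseChange

variable {A G M : Type*} [CommRing A] [Group G] [AddCommGroup M] [Module A M]
  (B : Type*) [CommRing B] [Algebra A B] {σ : Representation A G M}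

@[simp]
theorem baseChangeRep_tmul (g : G) (b : B) (m : M) :
    baseChangeRep B σ g (b ⊗ₜ[A] m) = b ⊗ₜ[A] σ g m := rfl

theorem tmul_mem_fixedVectors {K : Subgroup G} {m : M} (hm : m ∈ fixedVectors σ K) (b : B) :
    b ⊗ₜ[A] m ∈ fixedVectors (baseChangeRep B σ) K := by
  rw [mem_fixedVectors] at hm ⊢
  intro k hk
  rw [baseChangeRep_tmul, hm k hk]

theorem span_orbit_baseChangeRep_eq_top {v : M}
    (h : Submodule.span A (Set.range fun g => σ g v) = ⊤) :
    Submodule.span B (Set.range fun g => baseChangeRep B σ g ((1 : B) ⊗ₜ[A] v)) = ⊤ := by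
  rw [← Submodule.baseChange_top, ← h, Submodule.baseChange_span, ← Set.range_comp]
  rfl

end BaseChange

end GL2Pairing

theorem mainTheorem5
    {F : Type*} [Field F] [CharZero F] [ValuativeRel F] [TopologicalSpace F]
    [IsNonarchimedeanLocalField F]
    (p q : ℕ) [CharP 𝓀[F] p] (hq : q = Nat.card 𝓀[F])
    (A : Subring ℂ) [IsPrincipalIdealRing A] (hp : IsUnit (p : A))
    {V₁ V₂ : Type*} [AddCommGroup V₁] [Module ℂ V₁] [AddCommGroup V₂] [Module ℂ V₂]
    (π₁ : Representation ℂ (Matrix.GeneralLinearGroup (Fin 2) F) V₁)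
    (π₂ : Representation ℂ (Matrix.GeneralLinearGroup (Fin 2) F) V₂)
    (smooth₁ : GL2Pairing.IsSmooth π₁) (smooth₂ : GL2Pairing.IsSmooth π₂)
    (irred₁ : π₁.IsIrreducible) (irred₂ : π₂.IsIrreducible)
    (infinite₁ : ¬ FiniteDimensional ℂ V₁) (infinite₂ : ¬ FiniteDimensional ℂ V₂)
    (ramified : 1 ≤ GL2Pairing.conductor π₁)
    (dual : ∃ P : GL2Pairing.InvPairing π₁ π₂, P ≠ 0)
    (M₁ : Submodule A V₁) (M₂ : Submodule A V₂)
    (model₁ : GL2Pairing.IsModel A π₁ M₁) (model₂ : GL2Pairing.IsModel A π₂ M₂)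
    (v₁ : M₁) (v₂ : M₂)
    (new₁ : GL2Pairing.IsNewform π₁ (v₁ : V₁)) (new₂ : GL2Pairing.IsNewform π₂ (v₂ : V₂))
    (gen₁ : Submodule.span A (Set.range fun g => π₁ g (v₁ : V₁)) = M₁)
    (gen₂ : Submodule.span A (Set.range fun g => π₂ g (v₂ : V₂)) = M₂)
    (B : Type*) [CommRing B] [Algebra A B] [RingHomSurjective (algebraMap A B)] :
    let σ₁ := GL2Pairing.restrictRep π₁ M₁ model₁.stable
    let σ₂ := GL2Pairing.restrictRep π₂ M₂ model₂.stable
    let HomA := GL2Pairing.InvPairing σ₁ σ₂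
    let HomB := GL2Pairing.InvPairing
      (GL2Pairing.baseChangeRep B σ₁) (GL2Pairing.baseChangeRep B σ₂)
    let toB : HomA →ₛₗ[algebraMap A B] HomB := GL2Pairing.baseChangePairing B
    (∀ x : HomB ⧸ LinearMap.range toB, ((q : B) - 1) ^ 2 • x = 0) ∧
    (∃! P₀ : HomA, P₀ (v₁ ⊗ₜ[A] v₂) = (q : A) - 1) ∧
    ∀ P₀ : HomA, P₀ (v₁ ⊗ₜ[A] v₂) = (q : A) - 1 →
      ∀ P : HomB,
        ((q : B) - 1) ^ 2 • P =
          (((q : B) - 1) * P (((1 : B) ⊗ₜ[A] v₁) ⊗ₜ[B] ((1 : B) ⊗ₜ[A] v₂))) • toB P₀ := by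
  intro σ₁ σ₂ HomA HomB toB
  obtain ⟨P, hP⟩ := dual
  have hc : GL2Pairing.conductor π₂ = GL2Pairing.conductor π₁ :=
    le_antisymm (GL2Pairing.conductor_le_of_pairing (GL2Pairing.InvPairing.swap_ne_zero hP) smooth₂ irred₁ new₁)
      (GL2Pairing.conductor_le_of_pairing hP smooth₁ irred₂ new₂)
  have hPv : P ((v₁ : V₁) ⊗ₜ[ℂ] (v₂ : V₂)) ≠ 0 :=
    P.apply_newforms_ne_zero hP smooth₁ irred₂ hc new₁ new₂
  have hv₂ : (v₂ : V₂) ∈ GL2Pairing.fixedVectors π₂ (GL2Pairing.U1 F (GL2Pairing.conductor π₁)) := hc ▸ new₂.mem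
  have hv₂' : v₂ ∈ GL2Pairing.fixedVectors σ₂ (GL2Pairing.U1 F (GL2Pairing.conductor π₁)) := GL2Pairing.mem_fixedVectors_restrictRep.2 hv₂
  -- The scalars a(g) depend on π₁ and its lattice only, not on a pairing, so they serve over A, B
  -- and ℂ alike.
  choose a ha using model₁.exists_sub_mem_augmentation hp smooth₁ ramified new₁.2
  rw [← hq] at ha
  have hq0 : (q : A) - 1 ≠ 0 := by
    have : 1 < q := hq ▸ Finite.one_lt_card
    rw [sub_ne_zero]
    exact_mod_cast this.ne'
  have span₁ := GL2Pairing.span_orbit_restrictRep_eq_top (hM := model₁.stable) gen₁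
  have span₂ := GL2Pairing.span_orbit_restrictRep_eq_top (hM := model₂.stable) gen₂
  have hA : ∀ P₀ : HomA, P₀ (v₁ ⊗ₜ[A] v₂) = (q : A) - 1 → ∀ g, P₀ (σ₁ g v₁ ⊗ₜ[A] v₂) = a g := by
    intro P₀ hP₀ g
    have h := GL2Pairing.eq_zero_of_mem_augmentation σ₁ (P₀.evalRight v₂) (P₀.evalRight_invariant hv₂') (ha g)
    rw [map_sub, map_smul, map_smul, sub_eq_zero, P₀.evalRight_apply, P₀.evalRight_apply, hP₀,
      smul_eq_mul, smul_eq_mul, mul_comm] at h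
    exact mul_right_cancel₀ hq0 h
  -- Over B one may not cancel q - 1, so it remains as a factor of Q; this single factor is already
  -- sharper than the asserted square.
  have hB : ∀ P₀ : HomA, P₀ (v₁ ⊗ₜ[A] v₂) = (q : A) - 1 → ∀ Q : HomB,
      ((q : B) - 1) • Q = Q (((1 : B) ⊗ₜ[A] v₁) ⊗ₜ[B] ((1 : B) ⊗ₜ[A] v₂)) • toB P₀ := by
    intro P₀ hP₀ Q
    refine GL2Pairing.InvPairing.ext_of_span (GL2Pairing.span_orbit_baseChangeRep_eq_top B span₁)
      (GL2Pairing.span_orbit_baseChangeRep_eq_top B span₂) fun g => ?_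
    have hinv := Q.evalRight_invariant (GL2Pairing.tmul_mem_fixedVectors B hv₂' (1 : B))
    -- The relation in M₁ is pushed directly into B by the A-linear, K-invariant map m ↦ Q(1 ⊗ m, 1
    -- ⊗ v₂).
    have h := GL2Pairing.eq_zero_of_mem_augmentation σ₁
      ((Q.evalRight ((1 : B) ⊗ₜ[A] v₂)).restrictScalars A ∘ₗ TensorProduct.mk A B M₁ 1)
      (fun k hk m => hinv k hk (1 ⊗ₜ[A] m)) (ha g)
    rw [map_sub, map_smul, map_smul, sub_eq_zero] at h
    have h' : algebraMap A B ((q : A) - 1) *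
        Q (((1 : B) ⊗ₜ[A] σ₁ g v₁) ⊗ₜ[B] ((1 : B) ⊗ₜ[A] v₂)) =
        algebraMap A B (a g) * Q (((1 : B) ⊗ₜ[A] v₁) ⊗ₜ[B] ((1 : B) ⊗ₜ[A] v₂)) := by
      rw [← Algebra.smul_def, ← Algebra.smul_def]
      exact h
    have h'' : toB P₀ (((1 : B) ⊗ₜ[A] σ₁ g v₁) ⊗ₜ[B] ((1 : B) ⊗ₜ[A] v₂))
        = algebraMap A B (a g) := by
      rw [GL2Pairing.baseChangePairing_tmul, hA P₀ hP₀]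
      simp
    rw [map_sub, map_natCast, map_one] at h'
    rw [GL2Pairing.baseChangeRep_tmul]
    change ((q : B) - 1) * Q _ = Q _ * toB P₀ _
    rw [h'', h', mul_comm]
  have hex : ∃ P₀ : HomA, P₀ (v₁ ⊗ₜ[A] v₂) = (q : A) - 1 := by
    -- With this scaling the value at (g v₁, v₂) is exactly a(g), hence in A.
    set d : ℂ := ((q : ℂ) - 1) / P ((v₁ : V₁) ⊗ₜ[ℂ] (v₂ : V₂))
    obtain ⟨Q, hQ⟩ := GL2Pairing.InvPairing.exists_restrict model₁.stable model₂.stable (d • P) gen₁ gen₂ <| by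
      intro g
      have h := GL2Pairing.eq_zero_of_mem_augmentation σ₁
        ((P.evalRight (v₂ : V₂)).restrictScalars A ∘ₗ M₁.subtype)
        (fun k hk m => P.evalRight_invariant hv₂ k hk (m : V₁)) (ha g)
      rw [map_sub, map_smul, map_smul, sub_eq_zero] at h
      have h' : ((q : ℂ) - 1) * P (π₁ g v₁ ⊗ₜ[ℂ] (v₂ : V₂))
          = a g * P ((v₁ : V₁) ⊗ₜ[ℂ] (v₂ : V₂)) := by
        simpa [Subring.smul_def] using h
      have e : (d • P) (π₁ g v₁ ⊗ₜ[ℂ] (v₂ : V₂)) = a g := by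
        change d * P (π₁ g v₁ ⊗ₜ[ℂ] (v₂ : V₂)) = a g
        rw [div_mul_eq_mul_div, h', mul_div_cancel_right₀ _ hPv]
      rw [e]
      exact (a g).2
    refine ⟨Q, Subtype.ext ?_⟩
    rw [hQ]
    change d * P _ = _
    rw [div_mul_cancel₀ _ hPv]
    simp
  have hmain : ∀ P₀ : HomA, P₀ (v₁ ⊗ₜ[A] v₂) = (q : A) - 1 → ∀ Q : HomB,
      ((q : B) - 1) ^ 2 • Q =
        (((q : B) - 1) * Q (((1 : B) ⊗ₜ[A] v₁) ⊗ₜ[B] ((1 : B) ⊗ₜ[A] v₂))) • toB P₀ := by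
    intro P₀ hP₀ Q
    rw [pow_two, mul_smul, mul_smul, hB P₀ hP₀ Q]
  obtain ⟨P₀, hP₀⟩ := hex
  refine ⟨fun x => ?_, ⟨P₀, hP₀, fun P₁ hP₁ => ?_⟩, hmain⟩
  · obtain ⟨Q, rfl⟩ := Submodule.Quotient.mk_surjective _ x
    rw [← Submodule.Quotient.mk_smul, Submodule.Quotient.mk_eq_zero, hmain P₀ hP₀]
    exact Submodule.smul_mem _ _ (LinearMap.mem_range_self _ _)
  · exact GL2Pairing.InvPairing.ext_of_span span₁ span₂ fun g => by rw [hA P₀ hP₀, hA P₁ hP₁]
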